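/- **Theorem.** For $n,k\ge 0$ let $B(n,k)$ be the number of Stirling permutations of order $n$ with exactly $k$ descents. Here a Stirling permutation of order $n$ is a word $w_1\cdots w_{2n}$ in which each of $1,\dots,n$ occurs exactly twice and every letter between the two occurrences of $a$ is larger than $a$, and a descent is an index $1\le i<2n$ with $w_i>w_{i+1}$. Let $T(z)=\sum_{n\ge1}n^{n-1}\frac{z^n}{n!}$ be the Cayley tree function, and put $w=\frac yx\exp\!\left(-\frac yx+(x-y)^2t\right)$. (a) $B(0,0)=1$ and $B(0,k)=0$ for $k\ge 1$. For all $n\ge1$ and $k\ge0$, with $B(n-1,-1)=0$, $$B(n,k)=(k+1)B(n-1,k)+(2n-k-1)B(n-1,k-1).$$ (b) Let $K$ be a field of characteristic $0$. Then $T(z)=z\,e^{T(z)}$ in $K[[z]]$. For every nonzero $x\in K$ (for instance $K=\mathbb Q(x)$ with $x$ an indeterminate), the following holds in the ring $K[[y,t]]$ of formal power series in the indeterminates $y$ and $t$: $$\sum_{n\ge0}\sum_{k=0}^{n}B(n,k)\,x^{2n-k}y^{k+1}\frac{t^n}{n!}=\frac{(x-y)\,T(w)}{1-T(w)}.$$ (c)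 Let $x,y,t\in\mathbb C$ satisfy $|y|<|x|$ and $\left|\frac yx e^{-y/x}\right|e^{|(x-y)^2t|}<e^{-1}$. Then the series $T(w)$ converges, $T(w)=w\,e^{T(w)}$, $T(w)\neq1$, and the identity in (b) holds as an identity of complex numbers, the series over $n$ on its left-hand side being absolutely convergent. -/

import Mathlib

/-- The set of Stirling `r`-permutations of order `n`: words in which each of the letters
`1, …, n` occurs exactly `r` times (and no other letter occurs), such that no letter standing
between two occurrences of a letter `a` is smaller than `a`. For `r = 2`, each letter between
the two occurrences of `a` is then larger than `a`. -/
def stirlingPermutations (r n : ℕ) : Set (List ℕ) :=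
  {w | (∀ a : ℕ, w.count a = if 1 ≤ a ∧ a ≤ n then r else 0) ∧
    ∀ a b : ℕ, List.Sublist [a, b, a] w → a ≤ b}

/-- The number of descents of a word: of pairs of adjacent letters `w_i, w_{i+1}` with
`w_i > w_{i+1}`. -/
def wordDescents (w : List ℕ) : ℕ :=
  (w.zip w.tail).countP (fun p => decide (p.2 < p.1))

/-- There are finitely many Stirling `r`-permutations of order `n`. -/
theorem stirlingPermutations_finite (r n : ℕ) : (stirlingPermutations r n).Finite := by
  rcases (stirlingPermutations r n).eq_empty_or_nonempty with h | ⟨w₀, h₀⟩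
  · rw [h]; exact Set.finite_empty
  · refine (w₀.permutations.toFinset.finite_toSet).subset ?_
    intro w hw
    simp only [List.coe_toFinset, Set.mem_ofPred_eq, List.mem_permutations]
    refine List.perm_iff_count.2 fun a => ?_
    rw [hw.1 a, h₀.1 a]

/-- `B^{(r)}(n, k)`: the number of Stirling `r`-permutations of order `n` with `k` descents. -/
noncomputable def stirlingDescentCount (r n k : ℕ) : ℕ :=
  {w ∈ stirlingPermutations r n | wordDescents w = k}.ncard

/-- `B(n, k) = B^{(2)}(n, k)`. -/
noncomputable abbrev stirlingB (n k : ℕ) : ℕ := stirlingDescentCount 2 n k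

/-- The coefficient `n^{n-1} / n!` of the tree series for `n ≥ 1`, and `0` for `n = 0`. -/
def treeCoeff (K : Type*) [Field K] (n : ℕ) : K :=
  if n = 0 then 0 else (n : K) ^ (n - 1) / (n.factorial : K)

/-- The Cayley tree function as a formal power series, `T(z) = ∑_{n ≥ 1} n^{n-1} z^n / n!`. -/
def treeSeries (K : Type*) [Field K] : PowerSeries K :=
  PowerSeries.mk (treeCoeff K)

/-- The Cayley tree function as the sum of its power series, `∑_{n ≥ 1} n^{n-1} z^n / n!`. -/
noncomputable def treeFun (z : ℂ) : ℂ := ∑' n : ℕ, treeCoeff ℂ n * z ^ n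

/-! In `K⟦y, t⟧` the variable `y` is `X 0` and the variable `t` is `X 1`. -/

/-- The formal power series `∑_n ∑_{k ≤ n} B(n, k) x^{2n-k} y^{k+1} t^n / n!` in `K⟦y, t⟧`,
given by its coefficients: only the term of index `n` contributes to the monomials `y^j t^n`. -/
noncomputable def stirlingSeries {K : Type*} [Field K] (x : K) : MvPowerSeries (Fin 2) K :=
  fun m => ∑ k ∈ Finset.range (m 1 + 1),
    if m 0 = k + 1 then
      (stirlingB (m 1) k : K) * x ^ (2 * m 1 - k) / ((m 1).factorial : K)
    else 0

/-- The formal power series `y / x` in `K⟦y, t⟧`. -/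
noncomputable def ratioSeries {K : Type*} [Field K] (x : K) : MvPowerSeries (Fin 2) K :=
  MvPowerSeries.C x⁻¹ * MvPowerSeries.X 0

/-- The formal power series `x - y` in `K⟦y, t⟧`. -/
noncomputable def diffSeries {K : Type*} [Field K] (x : K) : MvPowerSeries (Fin 2) K :=
  MvPowerSeries.C x - MvPowerSeries.X 0

/-- The formal power series `w = (y/x) exp(-y/x + (x-y)² t)` in `K⟦y, t⟧`. -/
noncomputable def wSeries {K : Type*} [Field K] [CharZero K] (x : K) :
    MvPowerSeries (Fin 2) K :=
  ratioSeries x *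
    (PowerSeries.exp K).subst
      (-ratioSeries x + diffSeries x ^ 2 * MvPowerSeries.X 1 : MvPowerSeries (Fin 2) K)

/-- The complex number `w = (y/x) exp(-y/x + (x-y)² t)`. -/
noncomputable def wNumber (x y t : ℂ) : ℂ :=
  y / x * Complex.exp (-(y / x) + (x - y) ^ 2 * t)

/-! Deleting the block of copies of the largest letter of a Stirling permutation of order `n + 1`
gives one of order `n`, and putting the block back at a descent or at the end creates no descent,
while every other place creates one. For the polynomials `P_n = ∑_k B(n, k) z^{k+1}` this means
`P_{n+1} = z (1 - z) P_n' + (2n + 1) z P_n`. Since `T = z e^T` gives `z T' = T / (1 - T)`, the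
operator `z d/dz` satisfies the same recurrence, so that `P_n(T) = (1 - T)^{2n+1} M_{n+1}`, where
`M_j = (z d/dz)^j T`.

As `∂w/∂t = (x - y)² w`, the `n`-th derivative of `(x - y) M_1(w)` with respect to `t` is
`(x - y)^{2n+1} M_{n+1}(w)`. At `t = 0` one has `T(w) = y/x`, so that its value there is
`x^{2n+1} P_n(y/x)`, and the Taylor series of `(x - y) M_1(w) = (x - y) T(w) / (1 - T(w))` in `t`
is the series on the left-hand side. Over `ℂ`, `T(w) = y/x` at `t = 0` because `z e^{-z}` is
injective on the unit disc, which contains both sides. -/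

section Descents

theorem wordDescents_cons_cons (a b : ℕ) (l : List ℕ) :
    wordDescents (a :: b :: l) = (if b < a then 1 else 0) + wordDescents (b :: l) := by
  simp [wordDescents, List.countP_cons, add_comm]

theorem wordDescents_nil : wordDescents [] = 0 := rfl

theorem wordDescents_singleton (a : ℕ) : wordDescents [a] = 0 := rfl

theorem wordDescents_replicate (r a : ℕ) : wordDescents (List.replicate r a) = 0 := by
  induction r with
  | zero => rfl
  | succ r ih =>
    rcases r with _ | r
    · rfl
    · rwa [List.replicate_succ, List.replicate_succ, wordDescents_cons_cons, if_neg (lt_irrefl a),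
        zero_add, ← List.replicate_succ]

theorem wordDescents_replicate_append_cons {r a b : ℕ} (hr : r ≠ 0) (h : b < a) (l : List ℕ) :
    wordDescents (List.replicate r a ++ b :: l) = wordDescents (b :: l) + 1 := by
  obtain ⟨r, rfl⟩ := Nat.exists_eq_succ_of_ne_zero hr
  induction r with
  | zero => simp [wordDescents_cons_cons, h, add_comm]
  | succ r ih =>
    rw [List.replicate_succ, List.cons_append, List.replicate_succ, List.cons_append,
      wordDescents_cons_cons, if_neg (lt_irrefl a), zero_add, ← List.cons_append,
      ← List.replicate_succ, ih r.succ_ne_zero]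

/-- The word `u` with a block of `r` letters `N` inserted in front of its `i`-th letter, counted
from `0`; the block goes to the end if `u` has no `i`-th letter. -/
def insertBlock (r N : ℕ) (u : List ℕ) (i : ℕ) : List ℕ :=
  u.take i ++ List.replicate r N ++ u.drop i

variable {r N : ℕ}

theorem insertBlock_cons_succ (a : ℕ) (l : List ℕ) (i : ℕ) :
    insertBlock r N (a :: l) (i + 1) = a :: insertBlock r N l i := by
  simp [insertBlock]

theorem wordDescents_insertBlock_nil (i : ℕ) : wordDescents (insertBlock r N [] i) = 0 := by
  simp [insertBlock, wordDescents_replicate]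

theorem wordDescents_insertBlock_zero {b : ℕ} (hr : r ≠ 0) (hb : b < N) (l : List ℕ) :
    wordDescents (insertBlock r N (b :: l) 0) = wordDescents (b :: l) + 1 := by
  simp [insertBlock, wordDescents_replicate_append_cons hr hb]

theorem wordDescents_cons_insertBlock_zero {a : ℕ} (hr : r ≠ 0) (ha : a < N) (l : List ℕ) :
    wordDescents (a :: insertBlock r N l 0) = wordDescents (insertBlock r N l 0) := by
  obtain ⟨r, rfl⟩ := Nat.exists_eq_succ_of_ne_zero hr
  simp [insertBlock, List.replicate_succ, wordDescents_cons_cons, ha.le]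

theorem wordDescents_cons_insertBlock_succ (a b : ℕ) (l : List ℕ) (i : ℕ) :
    wordDescents (a :: insertBlock r N (b :: l) (i + 1)) =
      (if b < a then 1 else 0) + wordDescents (insertBlock r N (b :: l) (i + 1)) := by
  rw [insertBlock_cons_succ, wordDescents_cons_cons]

-- Insertion at a descent or at the end keeps the number `d` of descents, insertion at any of the
-- other `u.length - d` places increases it by one.
theorem sum_wordDescents_insertBlock {R : Type*} [CommRing R] (hr : r ≠ 0) {u : List ℕ}
    (hu : ∀ a ∈ u, a < N) (f : ℕ → R) :
    ∑ i ∈ Finset.range (u.length + 1), f (wordDescents (insertBlock r N u i)) =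
      (wordDescents u + 1) * f (wordDescents u) +
        (u.length - wordDescents u) * f (wordDescents u + 1) := by
  induction u generalizing f with
  | nil => simp [wordDescents_insertBlock_nil, wordDescents_nil]
  | cons a l ih =>
    have ha : a < N := hu a List.mem_cons_self
    rw [Finset.sum_range_succ', wordDescents_insertBlock_zero hr ha]
    simp only [insertBlock_cons_succ]
    rcases l with _ | ⟨b, l⟩
    · simp [wordDescents_cons_insertBlock_zero hr ha, wordDescents_insertBlock_nil,
        wordDescents_singleton]
    have hbl : ∀ c ∈ b :: l, c < N := fun c hc => hu c (List.mem_cons_of_mem a hc)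
    have hb : b < N := hbl b List.mem_cons_self
    have ih' := ih hbl fun d => f ((if b < a then 1 else 0) + d)
    rw [List.length_cons, Finset.sum_range_succ', wordDescents_insertBlock_zero hr hb,
      ← eq_sub_iff_add_eq] at ih'
    rw [List.length_cons, Finset.sum_range_succ', wordDescents_cons_insertBlock_zero hr ha,
      wordDescents_insertBlock_zero hr hb, wordDescents_cons_cons, List.length_cons]
    simp only [wordDescents_cons_insertBlock_succ]
    rw [ih']
    split_ifs <;> simp only [add_comm 1, zero_add] <;> push_cast <;> ring

end Descents

section Insertion

theorem cons_sublist_append_iff_of_notMem {α : Type*} {a : α} {p l q : List α} (ha : a ∉ p) :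
    (a :: l).Sublist (p ++ q) ↔ (a :: l).Sublist q := by
  induction p with
  | nil => rfl
  | cons c p ih =>
    rw [List.mem_cons, not_or] at ha
    rw [List.cons_append, List.cons_sublist_cons', ih ha.2, or_iff_left fun h => ha.1 h.1]

theorem eq_of_sublist_append_replicate_append {α : Type*} {a b : α} {p q : List α} {r : ℕ}
    (hp : a ∉ p) (hq : a ∉ q) (h : [a, b, a].Sublist (p ++ List.replicate r a ++ q)) : b = a := by
  rw [List.append_assoc, cons_sublist_append_iff_of_notMem hp, ← List.reverse_sublist,
    List.reverse_append] at h
  have h' : [a, b, a].Sublist (List.replicate r a).reverse :=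
    (cons_sublist_append_iff_of_notMem (mt List.mem_reverse.1 hq)).1 h
  exact List.eq_of_mem_replicate (List.mem_reverse.1 (h'.subset (by simp)))

theorem exists_eq_replicate_append {α : Type*} [DecidableEq α] {a : α} {l : List α}
    (h : ∀ b, [b, a].Sublist l → b = a) :
    ∃ q, l = List.replicate (l.count a) a ++ q := by
  induction l with
  | nil => exact ⟨[], rfl⟩
  | cons c l ih =>
    by_cases hc : c = a
    · subst hc
      obtain ⟨q, hl⟩ := ih fun b hb => h b (hb.cons c)
      refine ⟨q, ?_⟩
      rw [List.count_cons_self, List.replicate_succ, List.cons_append, ← hl]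
    · have hl : a ∉ l := fun ha => hc (h c ((List.singleton_sublist.2 ha).cons_cons c))
      have hcl : a ∉ c :: l := by simp [Ne.symm hc, hl]
      exact ⟨c :: l, by simp [List.count_eq_zero_of_not_mem hcl]⟩

theorem exists_eq_append_replicate_append {α : Type*} [DecidableEq α] {a : α} {l : List α}
    (h : ∀ b, [a, b, a].Sublist l → b = a) :
    ∃ p q, l = p ++ List.replicate (l.count a) a ++ q := by
  by_cases ha : a ∈ l
  · obtain ⟨p, m, rfl, hp⟩ := List.eq_append_cons_of_mem ha
    obtain ⟨q, hm⟩ := exists_eq_replicate_append fun b (hb : [b, a].Sublist m) =>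
      h b ((hb.cons_cons a).trans (List.sublist_append_right p _))
    refine ⟨p, q, ?_⟩
    rw [List.count_append, List.count_eq_zero_of_not_mem hp, zero_add, List.count_cons_self,
      List.replicate_succ, List.append_assoc, List.cons_append, ← hm]
  · exact ⟨l, [], by simp [List.count_eq_zero_of_not_mem ha]⟩

variable {r n : ℕ}

theorem lt_of_mem_stirlingPermutations {u : List ℕ} (hu : u ∈ stirlingPermutations r n)
    {a : ℕ} (ha : a ∈ u) : a < n + 1 := by
  have hcount := hu.1 a
  have hpos := List.count_pos_iff.2 ha
  split_ifs at hcount <;> omega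

theorem succ_notMem_of_mem_stirlingPermutations {u : List ℕ} (hu : u ∈ stirlingPermutations r n) :
    n + 1 ∉ u :=
  fun h => lt_irrefl _ (lt_of_mem_stirlingPermutations hu h)

theorem length_of_mem_stirlingPermutations {u : List ℕ} (hu : u ∈ stirlingPermutations r n) :
    u.length = r * n := by
  have hletters : ∀ a ∈ u, a ∈ Finset.Icc 1 n := fun a ha => by
    have hcount := hu.1 a
    have hpos := List.count_pos_iff.2 ha
    rw [Finset.mem_Icc]
    split_ifs at hcount with h <;> omega
  rw [← Multiset.coe_card, ← Multiset.sum_count_eq_card (s := Finset.Icc 1 n) hletters,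
    Finset.sum_congr rfl fun a ha => by
      rw [Multiset.coe_count, hu.1 a, if_pos (Finset.mem_Icc.1 ha)]]
  simp [mul_comm]

theorem filter_insertBlock {N : ℕ} {u : List ℕ} (hu : N ∉ u) (i : ℕ) :
    (insertBlock r N u i).filter (fun a => decide (a ≠ N)) = u := by
  have filter_eq : ∀ l : List ℕ, N ∉ l → l.filter (fun a => decide (a ≠ N)) = l := fun l hl =>
    List.filter_eq_self.2 fun a ha => decide_eq_true (ne_of_mem_of_not_mem ha hl)
  rw [insertBlock, List.filter_append, List.filter_append,
    filter_eq _ (mt List.mem_of_mem_take hu), filter_eq _ (mt List.mem_of_mem_drop hu)]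
  simp

theorem idxOf_insertBlock (hr : r ≠ 0) {N : ℕ} {u : List ℕ} (hu : N ∉ u) {i : ℕ}
    (hi : i ≤ u.length) : (insertBlock r N u i).idxOf N = i := by
  obtain ⟨r, rfl⟩ := Nat.exists_eq_succ_of_ne_zero hr
  rw [insertBlock, List.append_assoc, List.idxOf_append_of_notMem (mt List.mem_of_mem_take hu)]
  simp [List.replicate_succ, hi]

theorem insertBlock_length_append (N : ℕ) (p q : List ℕ) :
    insertBlock r N (p ++ q) p.length = p ++ List.replicate r N ++ q := by
  simp [insertBlock]

theorem count_insertBlock (N : ℕ) (u : List ℕ) (i a : ℕ) :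
    (insertBlock r N u i).count a = u.count a + if a = N then r else 0 := by
  conv_rhs => rw [← List.take_append_drop i u]
  simp only [insertBlock, List.count_append, List.count_replicate, beq_iff_eq, eq_comm (a := N)]
  omega

theorem insertBlock_mem_stirlingPermutations {u : List ℕ} (hu : u ∈ stirlingPermutations r n)
    (i : ℕ) : insertBlock r (n + 1) u i ∈ stirlingPermutations r (n + 1) := by
  have hN := succ_notMem_of_mem_stirlingPermutations hu
  refine ⟨fun a => ?_, fun a b hab => ?_⟩
  · rw [count_insertBlock, hu.1 a]
    split_ifs <;> omega
  by_cases ha : a = n + 1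
  · subst ha
    exact (eq_of_sublist_append_replicate_append (mt List.mem_of_mem_take hN)
      (mt List.mem_of_mem_drop hN) hab).ge
  have hfilter := hab.filter fun c => decide (c ≠ n + 1)
  rw [filter_insertBlock hN] at hfilter
  by_cases hb : b = n + 1
  · have : a ∈ u := hfilter.subset (by simp [ha])
    exact hb ▸ (lt_of_mem_stirlingPermutations hu this).le
  · exact hu.2 a b (by simpa [ha, hb] using hfilter)

theorem exists_insertBlock_eq {v : List ℕ} (hv : v ∈ stirlingPermutations r (n + 1)) :
    ∃ u ∈ stirlingPermutations r n, ∃ i ≤ u.length, insertBlock r (n + 1) u i = v := by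
  have hblock : ∀ b, [n + 1, b, n + 1].Sublist v → b = n + 1 := fun b hb =>
    le_antisymm (Nat.lt_succ_iff.1 (lt_of_mem_stirlingPermutations hv (hb.subset (by simp))))
      (hv.2 _ b hb)
  obtain ⟨p, q, hpq⟩ := exists_eq_append_replicate_append hblock
  rw [hv.1, if_pos (by omega)] at hpq
  have hv' := insertBlock_length_append (r := r) (n + 1) p q ▸ hpq
  refine ⟨p ++ q, ⟨fun a => ?_, fun a b hab => hv.2 a b (hab.trans ?_)⟩, p.length, by simp,
    hv'.symm⟩
  · have hcount := count_insertBlock (r := r) (n + 1) (p ++ q) p.length a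
    rw [← hv', hv.1 a] at hcount
    split_ifs at hcount ⊢ <;> omega
  · rw [hpq, List.append_assoc]
    exact (List.sublist_append_right _ q).append_left p

theorem sum_wordDescents_stirlingPermutations_succ {R : Type*} [CommRing R] (hr : r ≠ 0)
    (f : ℕ → R) :
    ∑ v ∈ (stirlingPermutations_finite r (n + 1)).toFinset, f (wordDescents v) =
      ∑ u ∈ (stirlingPermutations_finite r n).toFinset,
        ((wordDescents u + 1) * f (wordDescents u) +
          (r * n - wordDescents u) * f (wordDescents u + 1)) := by
  have hsum : ∀ u ∈ (stirlingPermutations_finite r n).toFinset,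
      (wordDescents u + 1 : R) * f (wordDescents u) +
          (r * n - wordDescents u) * f (wordDescents u + 1) =
        ∑ i ∈ Finset.range (r * n + 1), f (wordDescents (insertBlock r (n + 1) u i)) := by
    intro u hu
    rw [Set.Finite.mem_toFinset] at hu
    rw [← length_of_mem_stirlingPermutations hu, sum_wordDescents_insertBlock hr fun a =>
      lt_of_mem_stirlingPermutations hu, length_of_mem_stirlingPermutations hu, Nat.cast_mul]
  rw [Finset.sum_congr rfl hsum, ← Finset.sum_product']
  symm
  refine Finset.sum_bij (fun p _ => insertBlock r (n + 1) p.1 p.2) ?_ ?_ ?_ fun _ _ => rfl <;>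
    simp only [Finset.mem_product, Set.Finite.mem_toFinset, Finset.mem_range, Nat.lt_succ_iff]
  · exact fun p hp => insertBlock_mem_stirlingPermutations hp.1 p.2
  · rintro ⟨u, i⟩ ⟨hu, hi⟩ ⟨u', i'⟩ ⟨hu', hi'⟩ h
    have hN := succ_notMem_of_mem_stirlingPermutations hu
    have hN' := succ_notMem_of_mem_stirlingPermutations hu'
    rw [← length_of_mem_stirlingPermutations hu] at hi
    rw [← length_of_mem_stirlingPermutations hu'] at hi'
    refine Prod.ext ?_ ?_
    · simpa only [filter_insertBlock hN, filter_insertBlock hN'] using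
        congrArg (List.filter fun a => decide (a ≠ n + 1)) h
    · simpa only [idxOf_insertBlock hr hN hi, idxOf_insertBlock hr hN' hi'] using
        congrArg (List.idxOf (n + 1)) h
  · intro v hv
    obtain ⟨u, hu, i, hi, rfl⟩ := exists_insertBlock_eq hv
    exact ⟨(u, i), ⟨hu, length_of_mem_stirlingPermutations hu ▸ hi⟩, rfl⟩

end Insertion

section DescentNumbers

open Polynomial

theorem natCast_stirlingDescentCount (R : Type*) [CommRing R] (r n k : ℕ) :
    (stirlingDescentCount r n k : R) =
      ∑ w ∈ (stirlingPermutations_finite r n).toFinset, if wordDescents w = k then 1 else 0 := by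
  rw [Finset.sum_boole, stirlingDescentCount, ← Set.ncard_coe_finset, Finset.coe_filter]
  simp only [Set.Finite.mem_toFinset]

theorem stirlingDescentCount_succ_zero {r : ℕ} (hr : r ≠ 0) (n : ℕ) :
    stirlingDescentCount r (n + 1) 0 = stirlingDescentCount r n 0 := by
  have hsum := natCast_stirlingDescentCount ℤ r (n + 1) 0
  rw [sum_wordDescents_stirlingPermutations_succ hr fun d => if d = 0 then (1 : ℤ) else 0] at hsum
  zify
  rw [hsum, natCast_stirlingDescentCount ℤ]
  refine Finset.sum_congr rfl fun w _ => ?_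
  split_ifs with h <;> simp_all

theorem stirlingDescentCount_succ_succ {r : ℕ} (hr : r ≠ 0) (n k : ℕ) :
    (stirlingDescentCount r (n + 1) (k + 1) : ℤ) =
      (k + 2) * stirlingDescentCount r n (k + 1) + (r * n - k) * stirlingDescentCount r n k := by
  rw [natCast_stirlingDescentCount ℤ,
    sum_wordDescents_stirlingPermutations_succ hr fun d => if d = k + 1 then (1 : ℤ) else 0,
    natCast_stirlingDescentCount ℤ, natCast_stirlingDescentCount ℤ, Finset.mul_sum, Finset.mul_sum,
    ← Finset.sum_add_distrib]
  refine Finset.sum_congr rfl fun w _ => ?_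
  simp only [add_left_inj]
  split_ifs with h h' <;> simp_all
  ring

theorem stirlingPermutations_zero (r : ℕ) : stirlingPermutations r 0 = {[]} := by
  refine Set.eq_singleton_iff_unique_mem.2 ⟨⟨fun a => ?_, fun a b h => ?_⟩, fun w hw => ?_⟩
  · rw [if_neg (by omega), List.count_nil]
  · simp at h
  · exact List.length_eq_zero_iff.1 (length_of_mem_stirlingPermutations hw)

theorem stirlingDescentCount_zero (r k : ℕ) :
    stirlingDescentCount r 0 k = if k = 0 then 1 else 0 := by
  have hsum := natCast_stirlingDescentCount ℤ r 0 k
  simp only [stirlingPermutations_zero, Set.toFinite_toFinset, Set.toFinset_singleton,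
    Finset.sum_singleton, wordDescents_nil] at hsum
  exact_mod_cast hsum.trans (if_congr eq_comm rfl rfl)

theorem wordDescents_le_of_mem_stirlingPermutations {r n : ℕ} (hr : r ≠ 0) {w : List ℕ}
    (hw : w ∈ stirlingPermutations r n) : wordDescents w ≤ n := by
  have hzero : ∀ m k, m < k → stirlingDescentCount r m k = 0 := by
    intro m
    induction m with
    | zero => exact fun k hk => by rw [stirlingDescentCount_zero, if_neg hk.ne']
    | succ m ih =>
      intro k hk
      obtain ⟨k, rfl⟩ := Nat.exists_eq_succ_of_ne_zero hk.ne_bot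
      have hrec := stirlingDescentCount_succ_succ hr m k
      rw [ih k (by omega), ih (k + 1) (by omega)] at hrec
      simpa using hrec
  by_contra! h
  have hempty := (Set.ncard_eq_zero ((stirlingPermutations_finite r n).sep _)).1 (hzero n _ h)
  exact Set.notMem_empty w (hempty ▸ ⟨hw, rfl⟩)

/-- The generating polynomial `∑ X ^ (k + 1)` of the Stirling `r`-permutations of order `n`, where
`k` is the number of descents. -/
noncomputable def stirlingDescentPolynomial (R : Type*) [CommRing R] (r n : ℕ) : R[X] :=
  ∑ w ∈ (stirlingPermutations_finite r n).toFinset, X ^ (wordDescents w + 1)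

theorem stirlingDescentPolynomial_zero (R : Type*) [CommRing R] (r : ℕ) :
    stirlingDescentPolynomial R r 0 = X := by
  simp [stirlingDescentPolynomial, stirlingPermutations_zero, wordDescents_nil]

theorem stirlingDescentPolynomial_succ (R : Type*) [CommRing R] {r : ℕ} (hr : r ≠ 0) (n : ℕ) :
    stirlingDescentPolynomial R r (n + 1) =
      X * (1 - X) * derivative (stirlingDescentPolynomial R r n) +
        (r * n + 1 : R[X]) * X * stirlingDescentPolynomial R r n := by
  simp only [stirlingDescentPolynomial]
  rw [sum_wordDescents_stirlingPermutations_succ hr fun d => (X : R[X]) ^ (d + 1),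
    derivative_sum, Finset.mul_sum, Finset.mul_sum, ← Finset.sum_add_distrib]
  refine Finset.sum_congr rfl fun w _ => ?_
  simp only [derivative_X_pow_succ, map_add, map_one, map_natCast]
  ring

theorem aeval_stirlingDescentPolynomial {R A : Type*} [CommRing R] [CommRing A] [Algebra R A]
    {r : ℕ} (hr : r ≠ 0) (n : ℕ) (a : A) :
    aeval a (stirlingDescentPolynomial R r n) =
      ∑ k ∈ Finset.range (n + 1), (stirlingDescentCount r n k : A) * a ^ (k + 1) := by
  have hmaps : ∀ w ∈ (stirlingPermutations_finite r n).toFinset,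
      wordDescents w ∈ Finset.range (n + 1) := fun w hw => Finset.mem_range_succ_iff.2 <|
    wordDescents_le_of_mem_stirlingPermutations hr ((Set.Finite.mem_toFinset _).1 hw)
  rw [stirlingDescentPolynomial, map_sum, ← Finset.sum_fiberwise_of_maps_to hmaps]
  refine Finset.sum_congr rfl fun k _ => ?_
  rw [natCast_stirlingDescentCount, ← Finset.sum_filter, Finset.sum_mul]
  refine Finset.sum_congr rfl fun w hw => ?_
  rw [map_pow, aeval_X, one_mul, (Finset.mem_filter.1 hw).2]

end DescentNumbers

section TreeSeries

open PowerSeries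

variable {K : Type*} [Field K]

/-- The power series `∑ m ^ j * m ^ (m - 1) / m! * z ^ m`, the result of applying `z d/dz` to the
Cayley tree function `j` times. -/
noncomputable def treeMomentSeries (K : Type*) [Field K] (j : ℕ) : PowerSeries K :=
  mk fun m => (m : K) ^ j * treeCoeff K m

theorem coeff_treeMomentSeries (j m : ℕ) :
    coeff m (treeMomentSeries K j) = (m : K) ^ j * treeCoeff K m :=
  coeff_mk _ _

theorem treeMomentSeries_zero : treeMomentSeries K 0 = treeSeries K := by
  simp [treeMomentSeries, treeSeries]

theorem X_mul_derivative_treeMomentSeries (j : ℕ) :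
    X * derivative K (treeMomentSeries K j) = treeMomentSeries K (j + 1) := by
  ext (_ | m)
  · simp [coeff_treeMomentSeries, treeCoeff]
  · rw [coeff_succ_X_mul, coeff_derivative, coeff_treeMomentSeries, coeff_treeMomentSeries]
    push_cast
    ring

theorem X_mul_derivative_treeSeries : X * derivative K (treeSeries K) = treeMomentSeries K 1 := by
  rw [← treeMomentSeries_zero, X_mul_derivative_treeMomentSeries]

theorem constantCoeff_treeSeries : constantCoeff (treeSeries K) = 0 := by
  rw [← coeff_zero_eq_constantCoeff_apply, treeSeries, coeff_mk, treeCoeff, if_pos rfl]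

theorem hasSubst_treeSeries : HasSubst (treeSeries K) :=
  HasSubst.of_constantCoeff_zero' constantCoeff_treeSeries

theorem powerSeries_subst_one {R τ : Type*} [CommRing R] {a : MvPowerSeries τ R}
    (ha : HasSubst a) : (1 : PowerSeries R).subst a = 1 := by
  rw [← coe_substAlgHom ha, map_one]

variable [CharZero K]

-- Up to the factor `N!`, the sum is the `N`-th difference of the polynomial `d ^ (N - 1)`.
theorem sum_treeCoeff_mul_neg_pow_div_factorial (N : ℕ) :
    ∑ d ∈ Finset.range (N + 1), treeCoeff K d * ((-(d : K)) ^ (N - d) / ((N - d).factorial : K)) =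
      if N = 1 then 1 else 0 := by
  rcases N with _ | _ | N
  · simp [treeCoeff]
  · simp [treeCoeff, Finset.sum_range_succ]
  set M := N + 1 + 1
  have factorial_ne_zero : ∀ m : ℕ, (m.factorial : K) ≠ 0 := fun m => by
    exact_mod_cast m.factorial_ne_zero
  have hdiff : ((fwdDiff 1)^[M] (fun z : K => z ^ (N + 1)) 0) / (M.factorial : K) = 0 := by
    rw [fwdDiff_iter_pow_eq_zero_of_lt (Nat.lt_succ_self _), Pi.zero_apply, zero_div]
  rw [if_neg (by omega), ← hdiff, fwdDiff_iter_eq_sum_shift, Finset.sum_div]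
  refine Finset.sum_congr rfl fun d hd => ?_
  have hdM : d ≤ M := Nat.lt_succ_iff.1 (Finset.mem_range.1 hd)
  rcases Nat.eq_zero_or_pos d with rfl | hd0
  · simp [treeCoeff]
  have hpow : (d : K) ^ (N + 1) = (d : K) ^ (d - 1) * (d : K) ^ (M - d) := by
    rw [← pow_add]; congr 1; omega
  rw [treeCoeff, if_neg hd0.ne', neg_pow]
  simp only [nsmul_eq_mul, mul_one, zero_add, hpow, zsmul_eq_mul, Int.cast_mul, Int.cast_pow,
    Int.cast_neg, Int.cast_one, Int.cast_natCast, Nat.cast_choose K hdM]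
  field_simp [factorial_ne_zero]

/-- The power series `z e^{-z}`, the compositional inverse of the Cayley tree function. -/
noncomputable def mulExpNegSeries (K : Type*) [Field K] [CharZero K] : PowerSeries K :=
  X * evalNegHom (exp K)

theorem constantCoeff_mulExpNegSeries : constantCoeff (mulExpNegSeries K) = 0 := by
  simp [mulExpNegSeries]

theorem hasSubst_mulExpNegSeries : HasSubst (mulExpNegSeries K) :=
  HasSubst.of_constantCoeff_zero' constantCoeff_mulExpNegSeries

theorem coeff_mulExpNegSeries_pow (d N : ℕ) :
    coeff N (mulExpNegSeries K ^ d) =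
      if d ≤ N then (-(d : K)) ^ (N - d) / ((N - d).factorial : K) else 0 := by
  rw [mulExpNegSeries, mul_pow, ← map_pow, exp_pow_eq_rescale_exp, coeff_X_pow_mul', evalNegHom]
  split_ifs with h
  · rw [coeff_rescale, coeff_rescale, coeff_exp, neg_pow (d : K)]
    simp [mul_assoc, div_eq_mul_inv]
  · rfl

theorem treeSeries_subst_mulExpNegSeries :
    (treeSeries K).subst (mulExpNegSeries K) = (X : PowerSeries K) := by
  ext N
  have hsupport : (Function.support fun d =>
      coeff d (treeSeries K) • coeff N (mulExpNegSeries K ^ d)) ⊆ ↑(Finset.range (N + 1)) := by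
    intro d hd
    by_contra hdN
    rw [Finset.coe_range, Set.mem_Iio, not_lt] at hdN
    refine hd ?_
    beta_reduce
    rw [coeff_mulExpNegSeries_pow, if_neg (by omega), smul_zero]
  rw [coeff_subst' hasSubst_mulExpNegSeries, finsum_eq_sum_of_support_subset _ hsupport, coeff_X,
    ← sum_treeCoeff_mul_neg_pow_div_factorial]
  refine Finset.sum_congr rfl fun d hd => ?_
  rw [coeff_mulExpNegSeries_pow, if_pos (Nat.lt_succ_iff.1 (Finset.mem_range.1 hd)), smul_eq_mul,
    treeSeries, coeff_mk]

theorem mulExpNegSeries_subst_treeSeries :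
    (mulExpNegSeries K).subst (treeSeries K) = (X : PowerSeries K) := by
  have hcoeff : coeff 1 (mulExpNegSeries K) = 1 := by
    simpa using coeff_mulExpNegSeries_pow (K := K) 1 1
  have : Invertible (coeff 1 (mulExpNegSeries K)) := hcoeff ▸ invertibleOne
  have hright := subst_substInv_right (mulExpNegSeries K) constantCoeff_mulExpNegSeries
  have hinv : treeSeries K = substInv (mulExpNegSeries K) := by
    have h := congrArg (subst (substInv (mulExpNegSeries K)))
      (treeSeries_subst_mulExpNegSeries (K := K))
    rw [subst_comp_subst_apply hasSubst_mulExpNegSeries (HasSubst.substInv _), hright,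
      subst_X (HasSubst.substInv _)] at h
    rw [← h, X_subst]
  rw [hinv, hright]

theorem mulExpNegSeries_subst {τ : Type*} {a : MvPowerSeries τ K} (ha : HasSubst a) :
    (mulExpNegSeries K).subst a = a * (exp K).subst (-a) := by
  rw [mulExpNegSeries, subst_mul ha, subst_X ha, evalNegHom, rescale_eq_subst,
    subst_comp_subst_apply (HasSubst.smul_X' _) ha, subst_smul ha, subst_X ha, neg_one_smul]

theorem treeSeries_subst_mul_exp_neg {τ : Type*} {a : MvPowerSeries τ K} (ha : HasSubst a) :
    (treeSeries K).subst (a * (exp K).subst (-a)) = a := by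
  rw [← mulExpNegSeries_subst ha, ← subst_comp_subst_apply hasSubst_mulExpNegSeries ha,
    treeSeries_subst_mulExpNegSeries, subst_X ha]

theorem treeSeries_eq_X_mul_exp : treeSeries K = X * (exp K).subst (treeSeries K) := by
  have hT := hasSubst_treeSeries (K := K)
  have hexp := congrArg (subst (treeSeries K)) (exp_mul_exp_neg_eq_one (A := K))
  have hX := mulExpNegSeries_subst_treeSeries (K := K)
  rw [subst_mul hT, powerSeries_subst_one hT] at hexp
  rw [mulExpNegSeries, subst_mul hT, subst_X hT] at hX
  linear_combination (exp K).subst (treeSeries K) * hX - treeSeries K * hexp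

theorem treeMomentSeries_one_mul :
    treeMomentSeries K 1 * (1 - treeSeries K) = treeSeries K := by
  have hderiv := congrArg (fun F => X * derivative K F) (treeSeries_eq_X_mul_exp (K := K))
  have hM := X_mul_derivative_treeSeries (K := K)
  simp only [Derivation.leibniz, derivative_subst hasSubst_treeSeries, derivative_exp, derivative_X,
    smul_eq_mul, mul_one] at hderiv
  linear_combination -(treeMomentSeries K 1 + 1) * treeSeries_eq_X_mul_exp (K := K) + hderiv -
    (1 - X * (exp K).subst (treeSeries K)) * hM

-- Applying `z d/dz` turns the identity for `n` into the identity for `n + 1`, because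
-- `z T' = T / (1 - T)` matches the recurrence of the polynomials.
theorem aeval_treeSeries_stirlingDescentPolynomial (n : ℕ) :
    Polynomial.aeval (treeSeries K) (stirlingDescentPolynomial K 2 n) =
      (1 - treeSeries K) ^ (2 * n + 1) * treeMomentSeries K (n + 1) := by
  induction n with
  | zero => simp [stirlingDescentPolynomial_zero, mul_comm, treeMomentSeries_one_mul]
  | succ n ih =>
    have hderiv := congrArg (X * derivative K ·) ih
    have hT : (1 - treeSeries K) * (X * derivative K (treeSeries K)) = treeSeries K := by
      rw [X_mul_derivative_treeSeries, mul_comm, treeMomentSeries_one_mul]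
    have hMoment := X_mul_derivative_treeMomentSeries (K := K) (n + 1)
    simp only [Derivation.comp_aeval_eq, Derivation.leibniz, Derivation.leibniz_pow, map_sub,
      Derivation.map_one_eq_zero, zero_sub, smul_eq_mul, nsmul_eq_mul, Nat.add_sub_cancel]
      at hderiv
    rw [stirlingDescentPolynomial_succ K two_ne_zero]
    simp only [map_add, map_mul, map_sub, map_one, map_natCast, Polynomial.aeval_X, ih]
    push_cast at hderiv ⊢
    linear_combination (1 - treeSeries K) ^ 2 * hderiv +
      (1 - treeSeries K) ^ (2 * n + 3) * hMoment -
      ((1 - treeSeries K) * Polynomial.aeval (treeSeries K)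
          (Polynomial.derivative (stirlingDescentPolynomial K 2 n)) +
        (2 * n + 1) * (1 - treeSeries K) ^ (2 * n + 1) * treeMomentSeries K (n + 1)) * hT

end TreeSeries

section MultivariateSeries

open MvPowerSeries Finsupp

variable {σ R : Type*} [CommRing R]

-- Dropping the constant term of `f = c + X f₁` gives
-- `∂ᵢ f(g) - f'(g) ∂ᵢ g = g (∂ᵢ f₁(g) - f₁'(g) ∂ᵢ g)`, so that the left-hand side is divisible by
-- every power of `g`.
theorem exists_pderiv_subst_eq (i : σ) {g : MvPowerSeries σ R} (hg : PowerSeries.HasSubst g)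
    (N : ℕ) (f : PowerSeries R) :
    ∃ G, pderiv R i (f.subst g) =
      (PowerSeries.derivative R f).subst g * pderiv R i g + g ^ N * G := by
  induction N generalizing f with
  | zero => exact ⟨_, by rw [pow_zero, one_mul, add_sub_cancel]⟩
  | succ N ih =>
    set f₁ : PowerSeries R := PowerSeries.mk fun m => PowerSeries.coeff (m + 1) f
    obtain ⟨G, hG⟩ := ih f₁
    have hf : f = PowerSeries.X * f₁ + PowerSeries.C (PowerSeries.constantCoeff f) :=
      PowerSeries.eq_X_mul_shift_add_const f
    refine ⟨G, ?_⟩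
    rw [hf]
    simp only [PowerSeries.subst_add hg, PowerSeries.subst_mul hg, PowerSeries.subst_X hg,
      PowerSeries.subst_C, map_add, Derivation.leibniz, PowerSeries.derivative_C, pderiv_C,
      PowerSeries.derivative_X, smul_eq_mul, mul_one, add_zero, hG]
    ring

theorem pderiv_powerSeries_subst (i : σ) (f : PowerSeries R) {g : MvPowerSeries σ R}
    (hg : PowerSeries.HasSubst g) :
    pderiv R i (f.subst g) = (PowerSeries.derivative R f).subst g * pderiv R i g := by
  classical
  ext e
  obtain ⟨k, hk⟩ : ∃ k, constantCoeff g ^ k = 0 := id hg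
  obtain ⟨G, hG⟩ := exists_pderiv_subst_eq i hg (k + degree e) f
  have hcoeff : coeff e (g ^ (k + degree e) * G) = 0 := by
    rw [coeff_mul]
    refine Finset.sum_eq_zero fun p hp => ?_
    rw [coeff_eq_zero_of_constantCoeff_nilpotent hk, zero_mul]
    rw [← Finset.HasAntidiagonal.mem_antidiagonal.1 hp, map_add]
    omega
  rw [hG, map_add, hcoeff, add_zero]

theorem rescale_powerSeries_subst [Finite σ] (a : σ → R) (f : PowerSeries R)
    {g : MvPowerSeries σ R} (hg : PowerSeries.HasSubst g) :
    rescale a (f.subst g) = f.subst (rescale a g) := by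
  rw [rescale_eq_subst, rescale_eq_subst, PowerSeries.subst, PowerSeries.subst,
    subst_comp_subst_apply hg.const (HasSubst.smul_X a)]

theorem rescale_X [Finite σ] (a : σ → R) (i : σ) :
    rescale a (X i : MvPowerSeries σ R) = C (a i) * X i := by
  rw [rescale_eq_subst, subst_X (HasSubst.smul_X a), Pi.smul_apply', smul_eq_C_mul]

theorem rescale_C [Finite σ] (a : σ → R) (c : R) :
    rescale a (C c : MvPowerSeries σ R) = C c := by
  rw [rescale_eq_subst, subst_C]

theorem coeff_iterate_pderiv (i : σ) (n : ℕ) (F : MvPowerSeries σ R) (e : σ →₀ ℕ) :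
    coeff e ((pderiv R i)^[n] F) = ((e i + 1).ascFactorial n : R) * coeff (e + single i n) F := by
  induction n generalizing F with
  | zero => simp
  | succ n ih =>
    rw [Function.iterate_succ_apply, ih, coeff_pderiv, add_assoc, ← single_add,
      Nat.ascFactorial_succ]
    simp
    ring

end MultivariateSeries

section FormalIdentity

open MvPowerSeries Finsupp

variable {K : Type*} [Field K]

theorem constantCoeff_ratioSeries (x : K) : constantCoeff (ratioSeries x) = 0 := by
  simp [ratioSeries]

theorem hasSubst_ratioSeries (x : K) : PowerSeries.HasSubst (ratioSeries x) :=
  PowerSeries.HasSubst.of_constantCoeff_zero (constantCoeff_ratioSeries x)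

theorem hasSubst_neg_ratioSeries_add (x : K) : PowerSeries.HasSubst
    (-ratioSeries x + diffSeries x ^ 2 * X 1 : MvPowerSeries (Fin 2) K) :=
  PowerSeries.HasSubst.of_constantCoeff_zero (by simp [constantCoeff_ratioSeries])

theorem C_mul_one_sub_ratioSeries {x : K} (hx : x ≠ 0) :
    C x * (1 - ratioSeries x) = diffSeries x := by
  rw [mul_sub, mul_one, ratioSeries, ← mul_assoc, ← map_mul, mul_inv_cancel₀ hx, map_one, one_mul,
    diffSeries]

theorem pderiv_one_ratioSeries (x : K) : pderiv K 1 (ratioSeries x) = 0 := by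
  simp [ratioSeries, pderiv_X_of_ne]

theorem pderiv_one_diffSeries (x : K) : pderiv K 1 (diffSeries x) = 0 := by
  simp [diffSeries, pderiv_X_of_ne]

theorem coeff_rescale_one_zero {e : Fin 2 →₀ ℕ} (he : e 1 = 0) (F : MvPowerSeries (Fin 2) K) :
    coeff e (rescale ![1, 0] F) = coeff e F := by
  rw [coeff_rescale, Finsupp.prod_fintype _ _ (by simp)]
  simp [he]

theorem rescale_ratioSeries (x : K) : rescale ![1, 0] (ratioSeries x) = ratioSeries x := by
  simp [ratioSeries, rescale_X, rescale_C]

theorem rescale_diffSeries (x : K) : rescale ![1, 0] (diffSeries x) = diffSeries x := by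
  simp [diffSeries, rescale_X, rescale_C]

variable [CharZero K]

theorem constantCoeff_wSeries (x : K) : constantCoeff (wSeries x) = 0 := by
  simp [wSeries, constantCoeff_ratioSeries]

theorem hasSubst_wSeries (x : K) : PowerSeries.HasSubst (wSeries x) :=
  PowerSeries.HasSubst.of_constantCoeff_zero (constantCoeff_wSeries x)

theorem pderiv_one_wSeries (x : K) :
    pderiv K 1 (wSeries x) = diffSeries x ^ 2 * wSeries x := by
  rw [wSeries, Derivation.leibniz, pderiv_one_ratioSeries,
    pderiv_powerSeries_subst 1 _ (hasSubst_neg_ratioSeries_add x), PowerSeries.derivative_exp,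
    map_add, map_neg, pderiv_one_ratioSeries, Derivation.leibniz, Derivation.leibniz_pow,
    pderiv_one_diffSeries, pderiv_X_self]
  simp only [smul_eq_mul, smul_zero, mul_zero, mul_one, add_zero, neg_zero, zero_add]
  ring

theorem rescale_wSeries (x : K) : rescale ![1, 0] (wSeries x) =
    ratioSeries x * (PowerSeries.exp K).subst (-ratioSeries x) := by
  rw [wSeries, map_mul, rescale_powerSeries_subst _ _ (hasSubst_neg_ratioSeries_add x), map_add,
    map_neg, map_mul, rescale_ratioSeries, rescale_X]
  simp

theorem pderiv_one_treeMomentSeries_subst_wSeries (x : K) (j : ℕ) :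
    pderiv K 1 ((treeMomentSeries K j).subst (wSeries x)) =
      diffSeries x ^ 2 * (treeMomentSeries K (j + 1)).subst (wSeries x) := by
  have hw := hasSubst_wSeries x
  rw [pderiv_powerSeries_subst 1 _ hw, pderiv_one_wSeries, ← X_mul_derivative_treeMomentSeries,
    PowerSeries.subst_mul hw, PowerSeries.subst_X hw]
  ring

theorem iterate_pderiv_one_diffSeries_mul (x : K) (n : ℕ) :
    (pderiv K 1)^[n] (diffSeries x * (treeMomentSeries K 1).subst (wSeries x)) =
      diffSeries x ^ (2 * n + 1) * (treeMomentSeries K (n + 1)).subst (wSeries x) := by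
  induction n with
  | zero => simp
  | succ n ih =>
    rw [Function.iterate_succ_apply', ih, Derivation.leibniz,
      pderiv_one_treeMomentSeries_subst_wSeries, Derivation.leibniz_pow, pderiv_one_diffSeries]
    simp only [smul_eq_mul, smul_zero, mul_zero, add_zero]
    ring

-- At `t = 0` the series `w` becomes `ρ e^{-ρ}` with `ρ = y / x`, so that `T(w) = ρ`.
theorem rescale_diffSeries_pow_mul {x : K} (hx : x ≠ 0) (n : ℕ) :
    rescale ![1, 0]
        (diffSeries x ^ (2 * n + 1) * (treeMomentSeries K (n + 1)).subst (wSeries x)) =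
      C (x ^ (2 * n + 1)) *
        Polynomial.aeval (ratioSeries x) (stirlingDescentPolynomial K 2 n) := by
  have hρ := hasSubst_ratioSeries x
  set w₀ := ratioSeries x * (PowerSeries.exp K).subst (-ratioSeries x)
  have hw₀ : PowerSeries.HasSubst w₀ :=
    PowerSeries.HasSubst.of_constantCoeff_zero (by simp [w₀, constantCoeff_ratioSeries])
  have hT : (treeSeries K).subst w₀ = ratioSeries x := treeSeries_subst_mul_exp_neg hρ
  have hP := congrArg (PowerSeries.substAlgHom hw₀)
    (aeval_treeSeries_stirlingDescentPolynomial (K := K) n)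
  rw [← Polynomial.aeval_algHom_apply] at hP
  simp only [map_mul, map_pow, map_sub, map_one, PowerSeries.coe_substAlgHom, hT] at hP
  rw [hP, map_mul, map_pow, rescale_diffSeries, rescale_powerSeries_subst _ _ (hasSubst_wSeries x),
    rescale_wSeries, ← C_mul_one_sub_ratioSeries hx, mul_pow, map_pow, mul_assoc]

theorem pow_two_mul_add_one_eq {M : Type*} [Monoid M] (x : M) {n k : ℕ}
    (hk : k ∈ Finset.range (n + 1)) : x ^ (2 * n + 1) = x ^ (2 * n - k) * x ^ (k + 1) := by
  rw [← pow_add]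
  congr 1
  have := Finset.mem_range.1 hk
  omega

theorem factorial_mul_coeff_stirlingSeries {x : K} (hx : x ≠ 0) {e : Fin 2 →₀ ℕ} (he : e 1 = 0)
    (n : ℕ) :
    (n.factorial : K) * coeff (e + single 1 n) (stirlingSeries x) =
      coeff e (C (x ^ (2 * n + 1)) *
        Polynomial.aeval (ratioSeries x) (stirlingDescentPolynomial K 2 n)) := by
  have he0 : ∀ k : ℕ, e = single 0 k ↔ e 0 = k := fun k => by
    refine ⟨fun h => by simp [h], fun h => Finsupp.ext fun i => ?_⟩
    fin_cases i <;> simp [h, he]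
  have hcoeff : coeff (e + single 1 n) (stirlingSeries x) = ∑ k ∈ Finset.range (n + 1),
      if e 0 = k + 1 then (stirlingB n k : K) * x ^ (2 * n - k) / (n.factorial : K) else 0 := by
    rw [coeff_apply, stirlingSeries]
    simp [he]
  rw [hcoeff, aeval_stirlingDescentPolynomial two_ne_zero, coeff_C_mul, map_sum, Finset.mul_sum,
    Finset.mul_sum]
  refine Finset.sum_congr rfl fun k hk => ?_
  have hfactorial : (n.factorial : K) ≠ 0 := Nat.cast_ne_zero.2 n.factorial_ne_zero
  rw [ratioSeries, mul_pow, ← map_pow, ← map_natCast (C (σ := Fin 2) (R := K)), coeff_C_mul,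
    coeff_C_mul, coeff_X_pow]
  simp only [he0, pow_two_mul_add_one_eq x hk, inv_pow]
  split_ifs
  · field_simp
  · simp

theorem stirlingSeries_eq_diffSeries_mul {x : K} (hx : x ≠ 0) :
    stirlingSeries x = diffSeries x * (treeMomentSeries K 1).subst (wSeries x) := by
  ext m
  obtain ⟨e, n, he, rfl⟩ : ∃ e n, e 1 = 0 ∧ m = e + single 1 n :=
    ⟨m.erase 1, m 1, Finsupp.erase_same, (Finsupp.erase_add_single 1 m).symm⟩
  have hcoeff := coeff_iterate_pderiv (1 : Fin 2) n
    (diffSeries x * (treeMomentSeries K 1).subst (wSeries x)) e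
  rw [iterate_pderiv_one_diffSeries_mul, ← coeff_rescale_one_zero he,
    rescale_diffSeries_pow_mul hx, ← factorial_mul_coeff_stirlingSeries hx he, he, zero_add,
    Nat.one_ascFactorial] at hcoeff
  exact mul_left_cancel₀ (Nat.cast_ne_zero.2 n.factorial_ne_zero) hcoeff

theorem stirlingSeries_eq {x : K} (hx : x ≠ 0) :
    stirlingSeries x =
      diffSeries x * (treeSeries K).subst (wSeries x)
        * (1 - (treeSeries K).subst (wSeries x))⁻¹ := by
  have hw := hasSubst_wSeries x
  have hmoment := congrArg (PowerSeries.substAlgHom hw) (treeMomentSeries_one_mul (K := K))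
  simp only [map_mul, map_sub, map_one, PowerSeries.coe_substAlgHom] at hmoment
  have hconst : constantCoeff (1 - (treeSeries K).subst (wSeries x)) ≠ 0 := by
    rw [map_sub, map_one, PowerSeries.constantCoeff_subst_eq_zero (constantCoeff_wSeries x) _
      constantCoeff_treeSeries, sub_zero]
    exact one_ne_zero
  rw [stirlingSeries_eq_diffSeries_mul hx, MvPowerSeries.eq_mul_inv_iff_mul_eq hconst,
    mul_assoc, hmoment]

end FormalIdentity

section AbsolutelyConvergentSeries

theorem coeff_mul_mul_pow {R : Type*} [CommSemiring R] (F G : PowerSeries R) (w : R) (n : ℕ) :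
    PowerSeries.coeff n (F * G) * w ^ n = ∑ p ∈ Finset.HasAntidiagonal.antidiagonal n,
      PowerSeries.coeff p.1 F * w ^ p.1 * (PowerSeries.coeff p.2 G * w ^ p.2) := by
  rw [PowerSeries.coeff_mul, Finset.sum_mul]
  refine Finset.sum_congr rfl fun p hp => ?_
  rw [← Finset.HasAntidiagonal.mem_antidiagonal.1 hp, pow_add]
  ring

variable {𝕜 : Type*} [NormedField 𝕜]

/-- The algebra of the power series that converge absolutely at `w`. -/
def absConvergentSeries (w : 𝕜) : Subalgebra 𝕜 (PowerSeries 𝕜) where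
  carrier := {F | Summable fun n => ‖PowerSeries.coeff n F * w ^ n‖}
  mul_mem' {F G} hF hG := by
    simpa only [Set.mem_ofPred_eq, coeff_mul_mul_pow] using
      summable_norm_sum_mul_antidiagonal_of_summable_norm hF hG
  add_mem' {F G} hF hG := by
    refine (hF.add hG).of_norm_bounded fun n => ?_
    rw [norm_norm, map_add, add_mul]
    exact norm_add_le _ _
  algebraMap_mem' c := summable_of_ne_finset_zero (s := {0}) fun n hn => by
    rw [PowerSeries.algebraMap_apply, PowerSeries.coeff_C, if_neg (by simpa using hn), zero_mul,
      norm_zero]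

/-- Evaluation at `w` of the power series that converge absolutely there. -/
noncomputable def absConvergentSeriesEval [CompleteSpace 𝕜] (w : 𝕜) :
    absConvergentSeries w →ₐ[𝕜] 𝕜 where
  toFun F := ∑' n, PowerSeries.coeff n F.1 * w ^ n
  map_one' := by
    rw [tsum_eq_single 0 fun n hn => by simp [PowerSeries.coeff_one, hn]]
    simp
  map_zero' := by simp
  map_add' F G := by
    rw [← F.2.of_norm.tsum_add G.2.of_norm]
    simp [add_mul]
  map_mul' F G := by
    rw [tsum_mul_tsum_eq_tsum_sum_antidiagonal_of_summable_norm F.2 G.2]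
    exact tsum_congr (coeff_mul_mul_pow F.1 G.1 w)
  commutes' c := by
    rw [tsum_eq_single 0 fun n hn => by simp [PowerSeries.coeff_C, hn]]
    simp

end AbsolutelyConvergentSeries

section HolomorphicFunctions

open Complex

theorem eqOn_zero_of_mul_eq_zero {h : ℂ → ℂ} {U : Set ℂ} (hU : IsOpen U)
    (hh : DifferentiableOn ℂ h U) (hmul : ∀ w ∈ U, w * h w = 0) : Set.EqOn h 0 U := by
  intro w hw
  rcases eq_or_ne w 0 with rfl | hw0
  · have hder := (hasDerivAt_id (0 : ℂ)).mul (hh.differentiableAt (hU.mem_nhds hw)).hasDerivAt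
    have hzero : (id * h) =ᶠ[nhds 0] fun _ => 0 :=
      Filter.eventually_of_mem (hU.mem_nhds hw) hmul
    simpa using (hder.congr_of_eventuallyEq hzero.symm).unique (hasDerivAt_const 0 0)
  · exact (mul_eq_zero.1 (hmul w hw)).resolve_left hw0

theorem eq_mul_deriv_zero_of_mul_deriv_eq {f : ℂ → ℂ} {r : ℝ}
    (hf : DifferentiableOn ℂ f (Metric.ball 0 r))
    (hmul : ∀ w ∈ Metric.ball (0 : ℂ) r, w * deriv f w = f w) {w : ℂ}
    (hw : w ∈ Metric.ball 0 r) : f w = w * deriv f 0 := by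
  have hopen : IsOpen (Metric.ball (0 : ℂ) r) := Metric.isOpen_ball
  have hf' := hf.deriv hopen
  have hderiv₂ : Set.EqOn (deriv (deriv f)) 0 (Metric.ball 0 r) := by
    refine eqOn_zero_of_mul_eq_zero hopen (hf'.deriv hopen) fun v hv => ?_
    have hv' := hopen.mem_nhds hv
    have hprod := (hasDerivAt_id v).mul (hf'.differentiableAt hv').hasDerivAt
    have heq : f =ᶠ[nhds v] id * deriv f :=
      Filter.eventually_of_mem hv' fun u hu => (hmul u hu).symm
    simpa using (hprod.congr_of_eventuallyEq heq).unique (hf.differentiableAt hv').hasDerivAt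
  have h0 : (0 : ℂ) ∈ Metric.ball 0 r := Metric.mem_ball_self (Metric.pos_of_mem_ball hw)
  have hconst : deriv f w = deriv f 0 :=
    hopen.is_const_of_deriv_eq_zero (convex_ball 0 r).isPreconnected hf' hderiv₂ hw h0
  rw [← hmul w hw, hconst]

theorem norm_exp_sub_exp_le {r : ℝ} {s t : ℂ} (hs : ‖exp s‖ ≤ r) (ht : ‖exp t‖ ≤ r) :
    ‖exp s - exp t‖ ≤ r * ‖s - t‖ := by
  have hr : 0 < r := (norm_pos_iff.2 (exp_ne_zero s)).trans_le hs
  have hiff : ∀ u : ℂ, ‖exp u‖ ≤ r ↔ u ∈ {u : ℂ | u.re ≤ Real.log r} := fun u => by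
    rw [Complex.norm_exp, Set.mem_ofPred_eq, Real.le_log_iff_exp_le hr]
  exact (convex_halfSpace_re_le _).norm_image_sub_le_of_norm_hasDerivWithin_le
    (fun u _ => (hasDerivAt_exp u).hasDerivWithinAt) (fun u hu => (hiff u).2 hu)
    ((hiff t).1 ht) ((hiff s).1 hs)

-- If `z e^{-z} = v e^{-v}` with `v = e^s`, then `z = e^{s + z - v}`, and `exp` is a contraction on
-- the half-plane that contains `s` and `s + z - v`.
theorem injOn_mul_exp_neg : Set.InjOn (fun z : ℂ => z * exp (-z)) (Metric.ball 0 1) := by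
  intro z hz v hv hzv
  rw [mem_ball_zero_iff] at hz hv
  have hz_eq : z = v * exp (z - v) := by
    have h := congrArg (· * exp z) hzv
    simp only [mul_assoc, ← exp_add, neg_add_cancel, exp_zero, mul_one] at h
    rwa [neg_add_eq_sub] at h
  rcases eq_or_ne v 0 with rfl | hv0
  · simpa using hz_eq
  have hv_eq := exp_log hv0
  set s := log v
  have hz_exp : exp (s + (z - v)) = z := by rw [exp_add, hv_eq, ← hz_eq]
  have hle : ‖z - v‖ ≤ max ‖z‖ ‖v‖ * ‖z - v‖ := by
    simpa only [hz_exp, hv_eq, add_sub_cancel_left] using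
      norm_exp_sub_exp_le (r := max ‖z‖ ‖v‖) (s := s + (z - v)) (t := s)
        (by rw [hz_exp]; exact le_max_left _ _) (by rw [hv_eq]; exact le_max_right _ _)
  by_contra hne
  have hpos : 0 < ‖z - v‖ := norm_pos_iff.2 (sub_ne_zero.2 hne)
  exact (mul_lt_of_lt_one_left hpos (max_lt hz hv)).not_ge hle

end HolomorphicFunctions

section TreeFunction

open Metric

theorem norm_treeCoeff_le (n : ℕ) : ‖treeCoeff ℂ n‖ ≤ Real.exp n := by
  rw [treeCoeff]
  split_ifs with h
  · simpa using (Real.exp_pos _).le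
  · rw [norm_div, norm_pow, Complex.norm_natCast, Complex.norm_natCast]
    refine le_trans ?_ (Real.pow_div_factorial_le_exp (n : ℝ) n.cast_nonneg n)
    gcongr
    · exact_mod_cast Nat.one_le_iff_ne_zero.2 h
    · omega

theorem summable_norm_treeCoeff_mul_pow (j : ℕ) {r : ℝ} (h0 : 0 ≤ r) (hr : r < Real.exp (-1)) :
    Summable fun m : ℕ => ‖(m : ℂ) ^ j * treeCoeff ℂ m‖ * r ^ m := by
  have hlt : ‖Real.exp 1 * r‖ < 1 := by
    rw [Real.norm_of_nonneg (by positivity)]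
    calc Real.exp 1 * r < Real.exp 1 * Real.exp (-1) := by gcongr
      _ = 1 := by rw [← Real.exp_add, add_neg_cancel, Real.exp_zero]
  refine Summable.of_nonneg_of_le (fun m => by positivity) (fun m => ?_)
    (summable_pow_mul_geometric_of_norm_lt_one j hlt)
  rw [norm_mul, norm_pow, Complex.norm_natCast, mul_pow, ← Real.exp_nat_mul, mul_one, mul_assoc]
  gcongr
  exact norm_treeCoeff_le m

/-- The function `∑ m ^ j * m ^ (m - 1) / m! * w ^ m`, the sum of the series `treeMomentSeries ℂ j`
for `‖w‖ < e⁻¹`. -/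
noncomputable def treeMoment (j : ℕ) (w : ℂ) : ℂ :=
  ∑' m : ℕ, (m : ℂ) ^ j * treeCoeff ℂ m * w ^ m

theorem treeMoment_zero : treeMoment 0 = treeFun := by
  funext w
  simp [treeMoment, treeFun]

variable {w : ℂ}

theorem summable_norm_treeMoment (hw : ‖w‖ < Real.exp (-1)) (j : ℕ) :
    Summable fun m : ℕ => ‖(m : ℂ) ^ j * treeCoeff ℂ m * w ^ m‖ := by
  simpa only [norm_mul _ (w ^ _), norm_pow w] using
    summable_norm_treeCoeff_mul_pow j (norm_nonneg w) hw

theorem treeMomentSeries_mem_absConvergentSeries (hw : ‖w‖ < Real.exp (-1)) (j : ℕ) :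
    treeMomentSeries ℂ j ∈ absConvergentSeries w :=
  (summable_norm_treeMoment hw j).congr fun m => by rw [coeff_treeMomentSeries]

theorem summable_treeCoeff_mul_pow (hw : ‖w‖ < Real.exp (-1)) :
    Summable fun n : ℕ => treeCoeff ℂ n * w ^ n := by
  simpa only [pow_zero, one_mul] using (summable_norm_treeMoment hw 0).of_norm

-- Evaluation at `w` is multiplicative, so the identities of formal power series carry over.
theorem aeval_treeFun_stirlingDescentPolynomial (hw : ‖w‖ < Real.exp (-1)) (n : ℕ) :
    Polynomial.aeval (treeFun w) (stirlingDescentPolynomial ℂ 2 n) =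
      (1 - treeFun w) ^ (2 * n + 1) * treeMoment (n + 1) w := by
  let M (j : ℕ) : absConvergentSeries w := ⟨_, treeMomentSeries_mem_absConvergentSeries hw j⟩
  have hM (j : ℕ) : absConvergentSeriesEval w (M j) = treeMoment j w :=
    tsum_congr fun m => by rw [coeff_treeMomentSeries]
  have hformal : Polynomial.aeval (M 0) (stirlingDescentPolynomial ℂ 2 n) =
      (1 - M 0) ^ (2 * n + 1) * M (n + 1) := Subtype.ext <| by
    simpa only [Polynomial.aeval_subalgebra_coe, M, treeMomentSeries_zero] using!
      aeval_treeSeries_stirlingDescentPolynomial (K := ℂ) n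
  have heval := congrArg (absConvergentSeriesEval w) hformal
  rw [← Polynomial.aeval_algHom_apply] at heval
  simpa only [map_mul, map_pow, map_sub, map_one, hM, treeMoment_zero] using heval

theorem treeMoment_one_mul (hw : ‖w‖ < Real.exp (-1)) :
    treeMoment 1 w * (1 - treeFun w) = treeFun w := by
  have h := aeval_treeFun_stirlingDescentPolynomial hw 0
  rw [stirlingDescentPolynomial_zero, Polynomial.aeval_X] at h
  linear_combination -h

theorem treeFun_ne_one (hw : ‖w‖ < Real.exp (-1)) : treeFun w ≠ 1 := fun h => by
  simpa [h] using treeMoment_one_mul hw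

theorem differentiableOn_treeMoment_and_hasSum_deriv (j : ℕ) {r : ℝ} (h0 : 0 ≤ r)
    (hr : r < Real.exp (-1)) : DifferentiableOn ℂ (treeMoment j) (ball 0 r) ∧ ∀ w ∈ ball (0 : ℂ) r,
      HasSum (fun m : ℕ => (m : ℂ) ^ j * treeCoeff ℂ m * (m * w ^ (m - 1)))
        (deriv (treeMoment j) w) := by
  have hsum := summable_norm_treeCoeff_mul_pow j h0 hr
  have hdiff : ∀ m : ℕ, DifferentiableOn ℂ (fun w : ℂ => (m : ℂ) ^ j * treeCoeff ℂ m * w ^ m)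
      (ball 0 r) := fun m => by fun_prop
  have hle : ∀ (m : ℕ) (z : ℂ), z ∈ ball (0 : ℂ) r →
      ‖(m : ℂ) ^ j * treeCoeff ℂ m * z ^ m‖ ≤ ‖(m : ℂ) ^ j * treeCoeff ℂ m‖ * r ^ m := by
    intro m z hz
    have hzr : ‖z‖ < r := mem_ball_zero_iff.1 hz
    rw [norm_mul _ (z ^ m), norm_pow z]
    gcongr
  refine ⟨Complex.differentiableOn_tsum_of_summable_norm hsum hdiff isOpen_ball hle,
    fun w hw => ?_⟩
  simpa only [deriv_const_mul_field, deriv_pow_field] using!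
    Complex.hasSum_deriv_of_summable_norm hsum hdiff isOpen_ball hle hw

theorem hasSum_deriv_treeMoment (j : ℕ) (hw : ‖w‖ < Real.exp (-1)) :
    HasSum (fun m : ℕ => (m : ℂ) ^ j * treeCoeff ℂ m * (m * w ^ (m - 1)))
      (deriv (treeMoment j) w) := by
  obtain ⟨r, hwr, hr⟩ := exists_between hw
  exact (differentiableOn_treeMoment_and_hasSum_deriv j ((norm_nonneg w).trans hwr.le) hr).2 w
    (mem_ball_zero_iff.2 hwr)

theorem differentiableAt_treeMoment (j : ℕ) (hw : ‖w‖ < Real.exp (-1)) :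
    DifferentiableAt ℂ (treeMoment j) w := by
  obtain ⟨r, hwr, hr⟩ := exists_between hw
  exact (differentiableOn_treeMoment_and_hasSum_deriv j ((norm_nonneg w).trans
    hwr.le) hr).1.differentiableAt (isOpen_ball.mem_nhds (mem_ball_zero_iff.2 hwr))

theorem mul_deriv_treeMoment (j : ℕ) (hw : ‖w‖ < Real.exp (-1)) :
    w * deriv (treeMoment j) w = treeMoment (j + 1) w := by
  rw [← ((hasSum_deriv_treeMoment j hw).mul_left w).tsum_eq, treeMoment]
  refine tsum_congr fun m => ?_
  rcases m with _ | m
  · simp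
  · rw [Nat.add_sub_cancel]
    ring

theorem treeFun_zero : treeFun 0 = 0 := by
  rw [treeFun, tsum_eq_single 0 fun n hn => by simp [hn]]
  simp [treeCoeff]

theorem deriv_treeFun_zero : deriv treeFun 0 = 1 := by
  rw [← treeMoment_zero, ← (hasSum_deriv_treeMoment 0 (by simp [Real.exp_pos])).tsum_eq,
    tsum_eq_single 1 fun m hm => ?_]
  · simp [treeCoeff]
  · rcases m with _ | _ | m <;> simp_all

-- The function `g = T e^{-T}` satisfies `w g' = g`, because `w T' (1 - T) = T`.
theorem treeFun_mul_exp_neg_treeFun (hw : ‖w‖ < Real.exp (-1)) :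
    treeFun w * Complex.exp (-treeFun w) = w := by
  have hderiv : ∀ v ∈ ball (0 : ℂ) (Real.exp (-1)),
      HasDerivAt (fun v => treeFun v * Complex.exp (-treeFun v))
        (deriv treeFun v * (1 - treeFun v) * Complex.exp (-treeFun v)) v := fun v hv => by
    have hT := (treeMoment_zero ▸ differentiableAt_treeMoment 0 (mem_ball_zero_iff.1 hv)).hasDerivAt
    exact (hT.mul hT.fun_neg.cexp).congr_deriv (by ring)
  have hlinear := eq_mul_deriv_zero_of_mul_deriv_eq
    (fun v hv => (hderiv v hv).differentiableAt.differentiableWithinAt) (fun v hv => ?_)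
    (mem_ball_zero_iff.2 hw)
  · rwa [(hderiv 0 (mem_ball_self (Real.exp_pos _))).deriv, treeFun_zero, deriv_treeFun_zero,
      neg_zero, Complex.exp_zero, sub_zero, one_mul, mul_one, mul_one] at hlinear
  · have hv' := mem_ball_zero_iff.1 hv
    have hM := mul_deriv_treeMoment 0 hv'
    rw [treeMoment_zero] at hM
    rw [(hderiv v hv).deriv, ← mul_assoc, ← mul_assoc, hM, treeMoment_one_mul hv']

theorem treeFun_eq_mul_exp (hw : ‖w‖ < Real.exp (-1)) :
    treeFun w = w * Complex.exp (treeFun w) := by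
  conv_rhs => enter [1]; rw [← treeFun_mul_exp_neg_treeFun hw]
  rw [mul_assoc, ← Complex.exp_add, neg_add_cancel, Complex.exp_zero, mul_one]

theorem treeMoment_norm (j : ℕ) (w : ℂ) :
    treeMoment j ‖w‖ = (∑' m : ℕ, ‖(m : ℂ) ^ j * treeCoeff ℂ m * w ^ m‖ : ℝ) := by
  rw [treeMoment, Complex.ofReal_tsum]
  refine tsum_congr fun m => ?_
  rw [treeCoeff]
  split_ifs <;> simp

-- `M = z T'` and `T` are nonnegative at `‖w‖`, and `M (1 - T) = T`.
theorem norm_treeFun_lt_one (hw : ‖w‖ < Real.exp (-1)) : ‖treeFun w‖ < 1 := by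
  have hnorm : ‖(‖w‖ : ℂ)‖ < Real.exp (-1) := by rwa [Complex.norm_real, norm_norm]
  have hM := treeMoment_one_mul hnorm
  rw [← treeMoment_zero, treeMoment_norm, treeMoment_norm] at hM
  set M := ∑' m : ℕ, ‖(m : ℂ) ^ 1 * treeCoeff ℂ m * w ^ m‖
  set T := ∑' m : ℕ, ‖(m : ℂ) ^ 0 * treeCoeff ℂ m * w ^ m‖
  have hMT : M * (1 - T) = T := by exact_mod_cast hM
  have hM0 : 0 ≤ M := tsum_nonneg fun m => norm_nonneg _
  have hT : T < 1 := by
    by_contra! h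
    nlinarith
  refine lt_of_le_of_lt ?_ hT
  rw [← treeMoment_zero]
  exact norm_tsum_le_tsum_norm (summable_norm_treeMoment hw 0)

theorem treeFun_mul_exp_neg {z : ℂ} (hz : ‖z‖ < 1)
    (hw : ‖z * Complex.exp (-z)‖ < Real.exp (-1)) : treeFun (z * Complex.exp (-z)) = z :=
  injOn_mul_exp_neg (mem_ball_zero_iff.2 (norm_treeFun_lt_one hw)) (mem_ball_zero_iff.2 hz)
    (treeFun_mul_exp_neg_treeFun hw)

end TreeFunction

section NumericalIdentity

theorem iteratedDeriv_treeMoment_mul_exp (j n : ℕ) {f u : ℂ}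
    (hu : ‖f * Complex.exp u‖ < Real.exp (-1)) :
    iteratedDeriv n (fun v => treeMoment j (f * Complex.exp v)) u =
      treeMoment (j + n) (f * Complex.exp u) := by
  induction n generalizing u with
  | zero => rw [iteratedDeriv_zero, add_zero]
  | succ n ih =>
    have hopen : IsOpen {v : ℂ | ‖f * Complex.exp v‖ < Real.exp (-1)} :=
      isOpen_lt (by fun_prop) continuous_const
    have hev : iteratedDeriv n (fun v => treeMoment j (f * Complex.exp v)) =ᶠ[nhds u]
        fun v => treeMoment (j + n) (f * Complex.exp v) :=
      Filter.eventually_of_mem (hopen.mem_nhds hu) fun v hv => ih hv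
    have hderiv := (differentiableAt_treeMoment (j + n) hu).hasDerivAt.comp u
      ((Complex.hasDerivAt_exp u).const_mul f)
    rw [iteratedDeriv_succ, hev.deriv_eq, ← add_assoc, ← mul_deriv_treeMoment (j + n) hu, mul_comm]
    exact hderiv.deriv

theorem hasSum_treeMoment_mul_exp (j : ℕ) {f u : ℂ}
    (h : ‖f‖ * Real.exp ‖u‖ < Real.exp (-1)) :
    HasSum (fun n : ℕ => u ^ n / n.factorial * treeMoment (j + n) f)
      (treeMoment j (f * Complex.exp u)) := by
  have hcont : ContinuousAt (fun R : ℝ => ‖f‖ * Real.exp R) ‖u‖ := by fun_prop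
  obtain ⟨R, huR, hR⟩ : ∃ R, ‖u‖ < R ∧ ‖f‖ * Real.exp R < Real.exp (-1) :=
    ((hcont.eventually_lt_const h).filter_mono nhdsWithin_le_nhds |>.and
      (self_mem_nhdsWithin : Set.Ioi ‖u‖ ∈ _)).exists.imp fun R hR => ⟨hR.2, hR.1⟩
  have hball : ∀ v ∈ Metric.ball (0 : ℂ) R, ‖f * Complex.exp v‖ < Real.exp (-1) := fun v hv => by
    refine lt_of_le_of_lt ?_ hR
    rw [norm_mul]
    gcongr
    exact (Complex.norm_exp_le_exp_norm v).trans
      (Real.exp_le_exp.2 (mem_ball_zero_iff.1 hv).le)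
  have hdiff : DifferentiableOn ℂ (fun v => treeMoment j (f * Complex.exp v)) (Metric.ball 0 R) :=
    fun v hv => ((differentiableAt_treeMoment j (hball v hv)).comp v
      (Complex.differentiableAt_exp.const_mul f)).differentiableWithinAt
  have h0 := hball 0 (Metric.mem_ball_self ((norm_nonneg u).trans_lt huR))
  refine (Complex.hasSum_taylorSeries_on_ball hdiff (mem_ball_zero_iff.2 huR)).congr_fun fun n => ?_
  rw [iteratedDeriv_treeMoment_mul_exp j n h0, Complex.exp_zero, mul_one, sub_zero, smul_eq_mul,
    smul_eq_mul]
  ring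

theorem sum_stirlingB_mul_pow {K : Type*} [Field K] {x : K} (hx : x ≠ 0) (y : K) (n : ℕ) :
    ∑ k ∈ Finset.range (n + 1), (stirlingB n k : K) * x ^ (2 * n - k) * y ^ (k + 1) =
      x ^ (2 * n + 1) * Polynomial.aeval (y / x) (stirlingDescentPolynomial K 2 n) := by
  rw [aeval_stirlingDescentPolynomial two_ne_zero, Finset.mul_sum]
  refine Finset.sum_congr rfl fun k hk => ?_
  rw [pow_two_mul_add_one_eq x hk, div_pow]
  field_simp

theorem norm_wNumber_le (x y t : ℂ) : ‖wNumber x y t‖ ≤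
    ‖y / x * Complex.exp (-(y / x))‖ * Real.exp ‖(x - y) ^ 2 * t‖ := by
  rw [wNumber, Complex.exp_add, ← mul_assoc, norm_mul _ (Complex.exp ((x - y) ^ 2 * t))]
  gcongr
  exact Complex.norm_exp_le_exp_norm _

theorem hasSum_stirlingB {x y t : ℂ} (hxy : ‖y‖ < ‖x‖)
    (h : ‖y / x * Complex.exp (-(y / x))‖ * Real.exp ‖(x - y) ^ 2 * t‖ < Real.exp (-1)) :
    HasSum (fun n : ℕ => (∑ k ∈ Finset.range (n + 1),
        (stirlingB n k : ℂ) * x ^ (2 * n - k) * y ^ (k + 1)) * (t ^ n / n.factorial))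
      ((x - y) * treeFun (wNumber x y t) / (1 - treeFun (wNumber x y t))) := by
  have hx : x ≠ 0 := norm_pos_iff.1 ((norm_nonneg y).trans_lt hxy)
  have hz : ‖y / x‖ < 1 := by rwa [norm_div, div_lt_one (norm_pos_iff.2 hx)]
  have hw := (norm_wNumber_le x y t).trans_lt h
  have hf := (le_mul_of_one_le_right (norm_nonneg (y / x * Complex.exp (-(y / x))))
    (Real.one_le_exp (norm_nonneg ((x - y) ^ 2 * t)))).trans_lt h
  have hP := aeval_treeFun_stirlingDescentPolynomial hf
  rw [treeFun_mul_exp_neg hz hf] at hP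
  have hT : treeMoment 1 (wNumber x y t) =
      treeFun (wNumber x y t) / (1 - treeFun (wNumber x y t)) :=
    (eq_div_iff (sub_ne_zero.2 (treeFun_ne_one hw).symm)).2 (treeMoment_one_mul hw)
  have hsum := (hasSum_treeMoment_mul_exp 1 h).mul_left (x - y)
  rw [mul_assoc (y / x), ← Complex.exp_add, ← wNumber, hT, ← mul_div_assoc] at hsum
  refine hsum.congr_fun fun n => ?_
  have hxz : x - y = x * (1 - y / x) := by field_simp
  rw [sum_stirlingB_mul_pow hx, hP, ← mul_assoc, ← mul_pow, ← hxz, mul_pow _ t, ← pow_mul,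
    add_comm 1]
  ring

end NumericalIdentity

theorem mainTheorem5 :
    -- the recurrence of the numbers `B(n, k)`, with its initial values
    ((∀ k : ℕ, stirlingB 0 k = if k = 0 then 1 else 0) ∧
      (∀ n : ℕ, stirlingB (n + 1) 0 = stirlingB n 0) ∧
      (∀ n k : ℕ, 1 ≤ n → 1 ≤ k →
        (stirlingB n k : ℤ) =
          ((k : ℤ) + 1) * stirlingB (n - 1) k
            + (2 * (n : ℤ) - k - 1) * stirlingB (n - 1) (k - 1))) ∧
    -- the identity of formal power series in `y` and `t`
    (∀ (K : Type*) [Field K] [CharZero K],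
      treeSeries K = PowerSeries.X * (PowerSeries.exp K).subst (treeSeries K) ∧
      ∀ x : K, x ≠ 0 →
        stirlingSeries x =
          diffSeries x * (treeSeries K).subst (wSeries x)
            * (1 - (treeSeries K).subst (wSeries x))⁻¹) ∧
    -- the identity of numbers, where the series converge
    (∀ x y t : ℂ, ‖y‖ < ‖x‖ →
      ‖y / x * Complex.exp (-(y / x))‖ * Real.exp ‖(x - y) ^ 2 * t‖ < Real.exp (-1) →
        (Summable fun n : ℕ => treeCoeff ℂ n * wNumber x y t ^ n) ∧
        treeFun (wNumber x y t) = wNumber x y t * Complex.exp (treeFun (wNumber x y t)) ∧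
        treeFun (wNumber x y t) ≠ 1 ∧
        HasSum
          (fun n : ℕ =>
            (∑ k ∈ Finset.range (n + 1),
              (stirlingB n k : ℂ) * x ^ (2 * n - k) * y ^ (k + 1)) * (t ^ n / n.factorial))
          ((x - y) * treeFun (wNumber x y t) / (1 - treeFun (wNumber x y t)))) := by
  refine ⟨⟨stirlingDescentCount_zero 2, stirlingDescentCount_succ_zero two_ne_zero,
    fun n k hn hk => ?_⟩, fun K _ _ => ⟨treeSeries_eq_X_mul_exp, fun x hx => stirlingSeries_eq hx⟩,
    fun x y t hxy h => ?_⟩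
  · obtain ⟨n, rfl⟩ := Nat.exists_eq_add_of_le' hn
    obtain ⟨k, rfl⟩ := Nat.exists_eq_add_of_le' hk
    rw [Nat.add_sub_cancel, Nat.add_sub_cancel, stirlingDescentCount_succ_succ two_ne_zero]
    push_cast
    ring
  · have hw : ‖wNumber x y t‖ < Real.exp (-1) := (norm_wNumber_le x y t).trans_lt h
    exact ⟨summable_treeCoeff_mul_pow hw, treeFun_eq_mul_exp hw, treeFun_ne_one hw,
      hasSum_stirlingB hxy h⟩
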